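/- Let $\mathbf{k}$ be a field of characteristic different from $2$. Let $\mathrm{Aut}(\mathbf{k}^2)$ be the group of polynomial automorphisms of the affine plane over $\mathbf{k}$, that is, of the pairs $f=(f_1,f_2)$ of formal polynomials $f_1,f_2\in\mathbf{k}[x,y]$ that are invertible under composition. Let $A$ be its subgroup of affine automorphisms $(ax+by+r,\,cx+dy+s)$ with $ad-bc\neq0$, and let $B$ be its subgroup of elementary automorphisms $(ax+P(y),\,by+c)$ with $ab\neq 0$ and $P\in\mathbf{k}[y]$. Let $T$ be the Bass–Serre tree of $\mathrm{Aut}(\mathbf{k}^2)=A*_{A\cap B}B$: its vertices are the left cosets $fA$ and $fB$, its edges are the left cosets $f(A\cap B)$, joining $fA$ to $fB$, and $\mathrm{Aut}(\mathbf{k}^2)$ acts on it by left translation. Let $\mathrm{dist}$ be the distance in $T$ for which all edges have length $1$. Let $b=(-x+y^2,\,y)\in B$ and $t=(y,x)\in A$. Then: 1. $bt=(x^2-y,\,x)$. 2. $bt$ acts loxodromically on $T$: its translation length $\inf_v \mathrm{dist}(v,bt\,v)$, where $v$ runs over the vertices of $T$, is positive, and the vertices that realize it are those of a bi-infinite geodesic,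 the axis of $bt$, along which $bt$ acts as a translation. 3. $bt$ is a WPD element: for some vertex $v$ of $T$ and for every $\varepsilon\ge 0$ there is $N\in\mathbf{N}$ such that the set $$\{h\in \mathrm{Aut}(\mathbf{k}^2) \mid \mathrm{dist}(v,hv)\le\varepsilon \text{ and } \mathrm{dist}((bt)^N v,\,h(bt)^N v)\le\varepsilon\}$$ is finite. 4. The axis of $bt$ contains the path of length $6$ with the successive vertices $tbtB,\ tbA,\ tB,\ A,\ B,\ bA,\ btB$, and the pointwise stabilizer of this path in $\mathrm{Aut}(\mathbf{k}^2)$ is a finite group of order at most $3$. -/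

import Mathlib

/-! ### Polynomial automorphisms of the affine plane -/

/-- A polynomial self-map `(x, y) ↦ (fst, snd)` of the affine plane over `k`. It is a pair of formal
polynomials, in the variables `x = X 0` and `y = X 1`. -/
@[ext]
structure PolyMap (k : Type*) [Field k] where
  fst : MvPolynomial (Fin 2) k
  snd : MvPolynomial (Fin 2) k

namespace PolyMap

variable {k : Type*} [Field k]

/-- The identity `(x, y)`. -/
noncomputable instance : One (PolyMap k) := ⟨⟨MvPolynomial.X 0, MvPolynomial.X 1⟩⟩

/-- Composition: `f * g = f ∘ g`, that is, `g` is substituted into the components of `f`. -/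
noncomputable instance : Mul (PolyMap k) :=
  ⟨fun f g => ⟨MvPolynomial.aeval ![g.fst, g.snd] f.fst, MvPolynomial.aeval ![g.fst, g.snd] f.snd⟩⟩

@[simp] theorem one_fst : (1 : PolyMap k).fst = MvPolynomial.X 0 := rfl
@[simp] theorem one_snd : (1 : PolyMap k).snd = MvPolynomial.X 1 := rfl
@[simp] theorem mul_fst (f g : PolyMap k) :
    (f * g).fst = MvPolynomial.aeval ![g.fst, g.snd] f.fst := rfl
@[simp] theorem mul_snd (f g : PolyMap k) :
    (f * g).snd = MvPolynomial.aeval ![g.fst, g.snd] f.snd := rfl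

theorem aeval_aeval (f g : PolyMap k) (p : MvPolynomial (Fin 2) k) :
    MvPolynomial.aeval ![g.fst, g.snd] (MvPolynomial.aeval ![f.fst, f.snd] p) =
      MvPolynomial.aeval ![(f * g).fst, (f * g).snd] p := by
  rw [← AlgHom.comp_apply]
  congr 1
  ext i : 1
  fin_cases i <;> simp

theorem aeval_id (p : MvPolynomial (Fin 2) k) :
    MvPolynomial.aeval ![MvPolynomial.X 0, MvPolynomial.X 1] p = p := by
  conv_rhs => rw [← AlgHom.id_apply (R := k) p]
  congr 1
  ext i : 1
  fin_cases i <;> simp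

noncomputable instance : Monoid (PolyMap k) where
  mul_assoc f g h := by
    ext1
    · exact aeval_aeval g h f.fst
    · exact aeval_aeval g h f.snd
  one_mul f := by ext1 <;> simp
  mul_one f := by
    ext1
    · exact aeval_id f.fst
    · exact aeval_id f.snd

/-- The affine map `(a x + b y + e, c x + d y + f)`. -/
noncomputable def affine (a b c d e f : k) : PolyMap k :=
  ⟨MvPolynomial.C a * MvPolynomial.X 0 + MvPolynomial.C b * MvPolynomial.X 1 + MvPolynomial.C e,
    MvPolynomial.C c * MvPolynomial.X 0 + MvPolynomial.C d * MvPolynomial.X 1 + MvPolynomial.C f⟩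

/-- The elementary map `(a x + P(y), b y + c)`. -/
noncomputable def elementary (a b c : k) (P : Polynomial k) : PolyMap k :=
  ⟨MvPolynomial.C a * MvPolynomial.X 0 + Polynomial.aeval (MvPolynomial.X 1) P,
    MvPolynomial.C b * MvPolynomial.X 1 + MvPolynomial.C c⟩

theorem affine_one : affine 1 0 0 1 0 0 = (1 : PolyMap k) := by
  ext1 <;> simp [affine]

theorem affine_mul (a b c d e f a' b' c' d' e' f' : k) :
    affine a b c d e f * affine a' b' c' d' e' f' =
      affine (a * a' + b * c') (a * b' + b * d') (c * a' + d * c') (c * b' + d * d')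
        (a * e' + b * f' + e) (c * e' + d * f' + f) := by
  ext1
  · simp only [affine, mul_fst, map_add, map_mul, MvPolynomial.aeval_X, MvPolynomial.algHom_C,
      MvPolynomial.algebraMap_eq, Matrix.cons_val_zero, Matrix.cons_val_one]
    ring
  · simp only [affine, mul_snd, map_add, map_mul, MvPolynomial.aeval_X, MvPolynomial.algHom_C,
      MvPolynomial.algebraMap_eq, Matrix.cons_val_zero, Matrix.cons_val_one]
    ring

theorem elementary_one : elementary 1 1 0 0 = (1 : PolyMap k) := by
  ext1 <;> simp [elementary]

theorem elementary_mul (a b c a' b' c' : k) (P P' : Polynomial k) :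
    elementary a b c P * elementary a' b' c' P' =
      elementary (a * a') (b * b') (b * c' + c)
        (Polynomial.C a * P' + P.comp (Polynomial.C b' * Polynomial.X + Polynomial.C c')) := by
  ext1
  · simp only [elementary, mul_fst, map_add, map_mul, MvPolynomial.aeval_X, MvPolynomial.algHom_C,
      MvPolynomial.algebraMap_eq, Matrix.cons_val_zero, Polynomial.aeval_comp,
      Polynomial.aeval_C, Polynomial.aeval_X, ← Polynomial.aeval_algHom_apply,
      Matrix.cons_val_one]
    ring
  · simp only [elementary, mul_snd, map_add, map_mul, MvPolynomial.aeval_X, MvPolynomial.algHom_C,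
      MvPolynomial.algebraMap_eq, Matrix.cons_val_one, Matrix.cons_val_zero]
    ring

end PolyMap

/-- The group of polynomial automorphisms of the affine plane over `k`: the polynomial self-maps
that have a polynomial inverse, with composition `f * g = f ∘ g`. -/
abbrev PlaneAut (k : Type*) [Field k] := (PolyMap k)ˣ

namespace PlaneAut

/-- The subgroup of affine automorphisms. -/
noncomputable def affineSubgroup (k : Type*) [Field k] : Subgroup (PlaneAut k) where
  carrier := {g | ∃ a b c d e f : k, a * d - b * c ≠ 0 ∧
    (g : PolyMap k) = PolyMap.affine a b c d e f}
  one_mem' := ⟨1, 0, 0, 1, 0, 0, by simp, by rw [PolyMap.affine_one, Units.val_one]⟩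
  mul_mem' := by
    rintro g h ⟨a, b, c, d, e, f, hD, hg⟩ ⟨a', b', c', d', e', f', hD', hh⟩
    refine ⟨_, _, _, _, _, _, ?_, by rw [Units.val_mul, hg, hh, PolyMap.affine_mul]⟩
    convert mul_ne_zero hD hD' using 1
    ring
  inv_mem' := by
    rintro g ⟨a, b, c, d, e, f, hD, hg⟩
    set D := a * d - b * c with hDdef
    refine ⟨d / D, -b / D, -c / D, a / D, (b * f - d * e) / D, (c * e - a * f) / D, ?_, ?_⟩
    · have : d / D * (a / D) - -b / D * (-c / D) = 1 / D := by
        field_simp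
        rw [hDdef]; ring
      rw [this]
      exact one_div_ne_zero hD
    · rw [← Units.mul_eq_one_iff_inv_eq, hg, PolyMap.affine_mul, ← PolyMap.affine_one]
      congr 1 <;> field_simp <;> rw [hDdef] <;> ring

/-- The subgroup of elementary automorphisms. -/
noncomputable def elementarySubgroup (k : Type*) [Field k] : Subgroup (PlaneAut k) where
  carrier := {g | ∃ (a b c : k) (P : Polynomial k), a * b ≠ 0 ∧
    (g : PolyMap k) = PolyMap.elementary a b c P}
  one_mem' := ⟨1, 1, 0, 0, by simp, by rw [PolyMap.elementary_one, Units.val_one]⟩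
  mul_mem' := by
    rintro g h ⟨a, b, c, P, hD, hg⟩ ⟨a', b', c', P', hD', hh⟩
    refine ⟨_, _, _, _, ?_, by rw [Units.val_mul, hg, hh, PolyMap.elementary_mul]⟩
    convert mul_ne_zero hD hD' using 1
    ring
  inv_mem' := by
    rintro g ⟨a, b, c, P, hD, hg⟩
    obtain ⟨ha, hb⟩ := mul_ne_zero_iff.mp hD
    refine ⟨a⁻¹, b⁻¹, -(b⁻¹ * c), -(Polynomial.C a⁻¹ *
      P.comp (Polynomial.C b⁻¹ * Polynomial.X + Polynomial.C (-(b⁻¹ * c)))),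
      mul_ne_zero (inv_ne_zero ha) (inv_ne_zero hb), ?_⟩
    rw [← Units.mul_eq_one_iff_inv_eq, hg, PolyMap.elementary_mul, ← PolyMap.elementary_one]
    congr 1
    · field_simp
    · field_simp
    · field_simp; ring
    · rw [mul_neg, ← mul_assoc, ← Polynomial.C_mul, mul_inv_cancel₀ ha]
      simp

/-- The elementary involution `b = (-x + y², y)`. -/
noncomputable def b (k : Type*) [Field k] : PlaneAut k where
  val := ⟨-MvPolynomial.X 0 + MvPolynomial.X 1 ^ 2, MvPolynomial.X 1⟩
  inv := ⟨-MvPolynomial.X 0 + MvPolynomial.X 1 ^ 2, MvPolynomial.X 1⟩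
  val_inv := by ext1 <;> simp
  inv_val := by ext1 <;> simp

/-- The affine involution `t = (y, x)`. -/
noncomputable def t (k : Type*) [Field k] : PlaneAut k where
  val := ⟨MvPolynomial.X 1, MvPolynomial.X 0⟩
  inv := ⟨MvPolynomial.X 1, MvPolynomial.X 0⟩
  val_inv := by ext1 <;> simp
  inv_val := by ext1 <;> simp

end PlaneAut

/-! ### The Bass–Serre graph of two subgroups -/

/-- The Bass–Serre graph of two subgroups `A`, `B` of `G`: the vertices are the left cosets `g A`
and `g B`, and the edges are the left cosets `g (A ∩ B)`, where `g (A ∩ B)` joins `g A` to `g B`.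
(Distinct edges have distinct end points, since `g A ∩ g B = g (A ∩ B)`.) It is a tree when `G` is
the amalgamated product of `A` and `B` along `A ∩ B`. The group `G` acts by left translation. -/
def bassSerre {G : Type*} [Group G] (A B : Subgroup G) : SimpleGraph ((G ⧸ A) ⊕ (G ⧸ B)) where
  Adj u v := ∃ g : G, (u = Sum.inl (g : G ⧸ A) ∧ v = Sum.inr (g : G ⧸ B)) ∨
    (u = Sum.inr (g : G ⧸ B) ∧ v = Sum.inl (g : G ⧸ A))
  symm := ⟨by
    rintro u v ⟨g, ⟨hu, hv⟩ | ⟨hu, hv⟩⟩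
    · exact ⟨g, Or.inr ⟨hv, hu⟩⟩
    · exact ⟨g, Or.inl ⟨hv, hu⟩⟩⟩
  loopless := ⟨by
    rintro u ⟨g, ⟨hu, hv⟩ | ⟨hu, hv⟩⟩
    · rw [hu] at hv; cases hv
    · rw [hu] at hv; cases hv⟩

/-- The group acts on its Bass–Serre graph by graph automorphisms. -/
theorem bassSerre_adj_smul {G : Type*} [Group G] (A B : Subgroup G) (h : G)
    {u v : (G ⧸ A) ⊕ (G ⧸ B)} (huv : (bassSerre A B).Adj u v) :
    (bassSerre A B).Adj (h • u) (h • v) := by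
  obtain ⟨g, ⟨rfl, rfl⟩ | ⟨rfl, rfl⟩⟩ := huv
  · exact ⟨h * g, Or.inl ⟨rfl, rfl⟩⟩
  · exact ⟨h * g, Or.inr ⟨rfl, rfl⟩⟩

/-! ### Loxodromic and WPD elements of a group that acts on a graph

Distances are graph distances between vertices, with value `⊤` between different components. -/

section GraphAction

variable {G V : Type*} [Group G] [MulAction G V] (Γ : SimpleGraph V)

/-- The translation length `inf_x dist(x, g x)`. -/
noncomputable def translationLength (g : G) : ℕ∞ := ⨅ x : V, Γ.edist x (g • x)

/-- `γ` is the axis of `g`: it is a bi-infinite geodesic, along which `g` acts as a translation by its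
translation length `l`, with `0 < l < ⊤`, and the set `Min(g)` of the vertices realizing the
translation length is `γ`. (In a tree every vertex is reachable from `γ 0`; in a graph that is not
connected, `Min(g)` is taken in the component of `γ`.) -/
def IsAxis (g : G) (γ : ℤ → V) : Prop :=
  (∀ m n : ℤ, Γ.edist (γ m) (γ n) = ((m - n).natAbs : ℕ∞)) ∧
    (∃ l : ℕ, 0 < l ∧ translationLength Γ g = (l : ℕ∞) ∧ ∀ n : ℤ, g • γ n = γ (n + l)) ∧
    ∀ x : V, Γ.Reachable (γ 0) x →
      (Γ.edist x (g • x) = translationLength Γ g ↔ x ∈ Set.range γ)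

/-- `g` is loxodromic: it has positive translation length, realized along an axis. -/
def IsLoxodromic (g : G) : Prop := ∃ γ : ℤ → V, IsAxis Γ g γ

/-- The set `Fix_ε {x, y}` of the elements of `G` that move `x` and `y` by at most `ε`. Distances
between vertices being integers, it is enough to consider natural numbers `ε`. -/
def coarseFix (G : Type*) [Group G] [MulAction G V] (ε : ℕ) (x y : V) : Set G :=
  {h | Γ.edist x (h • x) ≤ (ε : ℕ∞) ∧ Γ.edist y (h • y) ≤ (ε : ℕ∞)}

/-- The WPD (weak proper discontinuity) condition: for some base vertex `x` and every `ε` there is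
`N` such that `Fix_ε {x, g ^ N x}` is finite. -/
def IsWPD (g : G) : Prop :=
  ∃ x : V, ∀ ε : ℕ, ∃ N : ℕ, (coarseFix Γ G ε x (g ^ N • x)).Finite

end GraphAction

namespace PlaneAut

/-- The vertex `f A` of the Bass–Serre tree, where `A` is the affine subgroup. -/
noncomputable def vertexA {k : Type*} [Field k] (f : PlaneAut k) :
    (PlaneAut k ⧸ affineSubgroup k) ⊕ (PlaneAut k ⧸ elementarySubgroup k) :=
  Sum.inl (f : PlaneAut k ⧸ affineSubgroup k)

/-- The vertex `f B` of the Bass–Serre tree, where `B` is the elementary subgroup. -/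
noncomputable def vertexB {k : Type*} [Field k] (f : PlaneAut k) :
    (PlaneAut k ⧸ affineSubgroup k) ⊕ (PlaneAut k ⧸ elementarySubgroup k) :=
  Sum.inr (f : PlaneAut k ⧸ elementarySubgroup k)

/-- The Bass–Serre tree of the group of polynomial automorphisms of the plane, for its structure of
amalgamated product of the affine and the elementary subgroups. -/
noncomputable def tree (k : Type*) [Field k] :
    SimpleGraph ((PlaneAut k ⧸ affineSubgroup k) ⊕ (PlaneAut k ⧸ elementarySubgroup k)) :=
  bassSerre (affineSubgroup k) (elementarySubgroup k)

end PlaneAut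

/-!
The proof does not use that `Aut(k²)` is the amalgamated product of `A` and `B`: everything
rests on the degrees of polynomial maps.

*The Bass–Serre graph is a forest* (`PlaneAut.isAcyclic_tree`). The degree of `w = f⁻¹` depends
only on the vertex `f A`. Passing from `f A` to another vertex `f' A` through a common neighbour
`f B` replaces `w = (w₁, w₂)` by `(α w₁ + P(w₂), β w₂ + c)` with `deg P ≥ 2`, which increases
the degree if `w₂` has the full degree of `w`; and for all neighbours of `f A` but at most one,
`w₂` does have full degree. Hence a cycle has no `A`-vertex of maximal degree
(`SimpleGraph.isAcyclic_of_height`).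

*`bt` fixes no vertex* (`PlaneAut.b_mul_t_smul_ne`). The iterates `(bt)^n` have degree `2^n`,
while those of an affine or elementary automorphism have bounded degrees, and so have their
conjugates. This applies to every component of the graph. As the action preserves the two kinds
of vertices, `bt` moves every vertex by at least `2`.

*The axis* (`isAxis_of_isAcyclic`). The vertices `(bt)^m A`, `(bt)^m B` form a path which `bt`
translates by `2`. It does not backtrack, `bt` having no fixed vertex, and in a forest such a
path is a geodesic. A vertex `x` at distance `d > 0` from it is moved by `2 * d + 2`, since the
path from `x` to the axis, along it, and on to `bt x` does not backtrack either.

*The stabilizer* (`PlaneAut.exists_eq_of_mem_fixingSubgroup`). An automorphism fixing `A`, `B`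
and `tB` is of the form `(a x + e, d y + f)`; fixing `btB` forces `a = d²` and `2 d f = 0`, and
symmetrically fixing `tbtB` forces `d = a²` and `2 a e = 0`. In characteristic other than `2`
there remain the maps `(a x, a² y)` with `a³ = 1`.

*WPD* (`isWPD_of_isAcyclic`). If `h` moves both ends of a long segment of the axis by at most
`ε`, it maps a subsegment in the middle, a translate of the segment of length `6`, into the long
segment. Such an `h` has finitely many possible restrictions to the subsegment, and each of them
determines `h` up to the finite stabilizer of the subsegment.
-/

/-! ### Forests -/

namespace SimpleGraph

variable {V : Type*} {Γ : SimpleGraph V}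

/-- Around a vertex of maximal height, a cycle leaves through two distinct neighbours `w`, `w'` and
returns to vertices of at most that height; the hypothesis excludes this. -/
theorem isAcyclic_of_height (φ : V → ℕ)
    (h : ∀ v w w', Γ.Adj v w → Γ.Adj v w' → w ≠ w' → φ v < φ w ∨
      (∀ u, Γ.Adj w u → u ≠ v → φ v < φ u) ∨ (∀ u, Γ.Adj w' u → u ≠ v → φ v < φ u)) :
    Γ.IsAcyclic := by
  classical
  intro v₀ c₀ hc₀
  obtain ⟨v, hv, hmax⟩ := c₀.support.toFinset.exists_max_image φ ⟨v₀, by simp⟩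
  rw [List.mem_toFinset] at hv
  have hc : (c₀.rotate v hv).IsCycle := hc₀.rotate hv
  have hle : ∀ i, φ ((c₀.rotate v hv).getVert i) ≤ φ v := fun i => hmax _ <| by
    rw [List.mem_toFinset, ← Walk.mem_support_rotate_iff c₀ v hv]
    exact Walk.getVert_mem_support _ _
  generalize c₀.rotate v hv = c at hc hle
  have hlen := hc.three_le_length
  have second : ∀ c : Γ.Walk v v, c.IsCycle → (∀ i, φ (c.getVert i) ≤ φ v) → 3 ≤ c.length →
      ¬ ∀ u, Γ.Adj c.snd u → u ≠ v → φ v < φ u := by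
    intro c hc hle hlen hu
    refine absurd (hle 2) (not_le.mpr (hu _ (c.adj_getVert_succ (i := 1) (by lia)) fun h2 => ?_))
    rcases (hc.getVert_endpoint_iff (i := 2) (by lia)).mp h2 with h | h <;> lia
  rcases h v c.snd c.penultimate (c.adj_snd hc.not_nil) (c.adj_penultimate hc.not_nil).symm
    hc.snd_ne_penultimate with h | h | h
  · exact absurd (hle 1) (not_le.mpr h)
  · exact second c hc hle hlen h
  · refine second c.reverse hc.reverse (fun i => ?_) (by simpa using hlen) (by simpa using h)
    rw [Walk.getVert_reverse]
    exact hle _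

/-- In a forest, a path that moves away from `x` keeps moving away as long as it does not
backtrack. -/
theorem IsAcyclic.dist_eq_dist_add_one_of_ne (hΓ : Γ.IsAcyclic) {x u v w : V}
    (hx : Γ.Reachable x u) (huv : Γ.Adj u v) (hvw : Γ.Adj v w) (hne : u ≠ w)
    (h : Γ.dist x v = Γ.dist x u + 1) : Γ.dist x w = Γ.dist x v + 1 := by
  have hxv := hx.trans huv.reachable
  refine (hΓ.dist_eq_dist_add_one_of_adj_of_reachable x hvw hxv).resolve_left fun h' => hne ?_
  obtain ⟨p, hp⟩ := hx.exists_walk_length_eq_dist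
  obtain ⟨q, hq⟩ := (hxv.trans hvw.reachable).exists_walk_length_eq_dist
  have hp' : (p.concat huv).IsPath :=
    Walk.isPath_of_length_eq_dist _ (by rw [Walk.length_concat, hp, h])
  have hq' : (q.concat hvw.symm).IsPath :=
    Walk.isPath_of_length_eq_dist _ (by rw [Walk.length_concat, hq, h'])
  have := congrArg (fun r : Γ.Path x v => r.1.penultimate)
    ((hΓ.subsingleton_path x v).elim ⟨_, hp'⟩ ⟨_, hq'⟩)
  simpa using this

/-- A sequence without backtracking in a forest, whose first step moves away from `x`, moves away
from `x` at every step. -/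
theorem IsAcyclic.dist_seq (hΓ : Γ.IsAcyclic) {x : V} {q : ℕ → V} {N : ℕ}
    (hadj : ∀ i < N, Γ.Adj (q i) (q (i + 1))) (hne : ∀ i, i + 2 ≤ N → q i ≠ q (i + 2))
    (hx : Γ.Reachable x (q 0)) (h1 : Γ.dist x (q 1) = Γ.dist x (q 0) + 1) {n : ℕ} (hn : n ≤ N) :
    Γ.dist x (q n) = Γ.dist x (q 0) + n := by
  have hr : ∀ i ≤ N, Γ.Reachable x (q i) := by
    intro i
    induction i with
    | zero => exact fun _ => hx
    | succ i ih => exact fun hi => (ih (by lia)).trans (hadj i hi).reachable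
  have step : ∀ i, i + 1 ≤ N → Γ.dist x (q (i + 1)) = Γ.dist x (q i) + 1 := by
    intro i
    induction i with
    | zero => exact fun _ => h1
    | succ i ih =>
      intro hi
      exact hΓ.dist_eq_dist_add_one_of_ne (hr i (by lia)) (hadj i (by lia)) (hadj (i + 1) (by lia))
        (hne i hi) (ih (by lia))
  induction n with
  | zero => rfl
  | succ n ih => rw [step n hn, ih (by lia)]; lia

/-- In a forest, a vertex between `a` and `b` lies on every walk from `a` to `b`. -/
theorem IsAcyclic.mem_support_of_dist_add_dist (hΓ : Γ.IsAcyclic) {a v b : V}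
    (hav : Γ.Reachable a v) (hvb : Γ.Reachable v b)
    (h : Γ.dist a v + Γ.dist v b = Γ.dist a b) (W : Γ.Walk a b) : v ∈ W.support := by
  classical
  obtain ⟨p, hp⟩ := hav.exists_walk_length_eq_dist
  obtain ⟨q, hq⟩ := hvb.exists_walk_length_eq_dist
  have hpq : (p.append q).IsPath :=
    Walk.isPath_of_length_eq_dist _ (by rw [Walk.length_append, hp, hq, h])
  have heq : p.append q = W.bypass := congrArg Subtype.val
    ((hΓ.subsingleton_path a b).elim ⟨_, hpq⟩ ⟨_, W.bypass_isPath⟩)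
  apply W.support_bypass_subset_support
  rw [← heq, Walk.mem_support_append_iff]
  exact Or.inl p.end_mem_support

theorem exists_walk_of_adj_seq {γ : ℤ → V} (hadj : ∀ n, Γ.Adj (γ n) (γ (n + 1))) (m : ℤ) (n : ℕ) :
    ∃ W : Γ.Walk (γ m) (γ (m + n)), ∀ v ∈ W.support, ∃ i, m ≤ i ∧ i ≤ m + n ∧ v = γ i := by
  induction n with
  | zero =>
    refine ⟨Walk.nil.copy rfl (by simp), fun v hv => ⟨m, le_rfl, by simp, by simpa using hv⟩⟩
  | succ n ih =>
    obtain ⟨W, hW⟩ := ih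
    refine ⟨(W.concat (hadj _)).copy rfl (by push_cast; rw [add_assoc]), fun v hv => ?_⟩
    rw [Walk.support_copy, Walk.support_concat, List.mem_append, List.mem_singleton] at hv
    rcases hv with hv | rfl
    · obtain ⟨i, h1, h2, h3⟩ := hW v hv
      exact ⟨i, h1, by push_cast; lia, h3⟩
    · exact ⟨_, by lia, by push_cast; lia, rfl⟩

/-- A sequence of adjacent vertices without backtracking in a forest is a bi-infinite geodesic. -/
theorem IsAcyclic.dist_bi_infinite (hΓ : Γ.IsAcyclic) {γ : ℤ → V}
    (hadj : ∀ n, Γ.Adj (γ n) (γ (n + 1))) (hne : ∀ n, γ n ≠ γ (n + 2)) (m n : ℤ) :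
    Γ.Reachable (γ m) (γ n) ∧ Γ.dist (γ m) (γ n) = (m - n).natAbs := by
  wlog h : m ≤ n generalizing m n
  · obtain ⟨h1, h2⟩ := this n m (by lia)
    exact ⟨h1.symm, by rw [dist_comm, h2]; lia⟩
  obtain ⟨d, rfl⟩ := Int.le.dest h
  refine ⟨(exists_walk_of_adj_seq hadj m d).choose.reachable, ?_⟩
  have := hΓ.dist_seq (x := γ m) (q := fun i => γ (m + i)) (N := d) (n := d)
    (fun i _ => by simpa [add_assoc] using hadj (m + i))
    (fun i _ => by simpa [add_assoc] using hne (m + i)) (by simp)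
    (by simpa using dist_eq_one_iff_adj.mpr (hadj m)) le_rfl
  simp only [Nat.cast_zero, add_zero, dist_self, zero_add] at this
  rw [this]
  lia

end SimpleGraph

/-! ### Automorphisms of a forest -/

section Forest

variable {G V : Type*} [Group G] [MulAction G V] {Γ : SimpleGraph V}

theorem reachable_smul (hsm : ∀ (h : G) {u v : V}, Γ.Adj u v → Γ.Adj (h • u) (h • v)) (h : G)
    {u v : V} (huv : Γ.Reachable u v) : Γ.Reachable (h • u) (h • v) :=
  huv.map ⟨(h • ·), hsm h⟩

theorem dist_smul_smul (hsm : ∀ (h : G) {u v : V}, Γ.Adj u v → Γ.Adj (h • u) (h • v)) (h : G)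
    {u v : V} (huv : Γ.Reachable u v) : Γ.dist (h • u) (h • v) = Γ.dist u v := by
  have key : ∀ (h : G) {u v : V}, Γ.Reachable u v → Γ.dist (h • u) (h • v) ≤ Γ.dist u v := by
    intro h u v huv
    obtain ⟨p, hp⟩ := huv.exists_walk_length_eq_dist
    rw [← hp, ← p.length_map ⟨(h • ·), hsm h⟩]
    exact Γ.dist_le _
  refine le_antisymm (key h huv) ?_
  simpa using key h⁻¹ (reachable_smul hsm h huv)

/-- A path `γ` without backtracking in a forest, along which `g` is a translation by `2`, is the
axis of `g` if no vertex is moved by less than `2`: a vertex at distance `d` from `γ` is moved by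
`2 * d + 2`. -/
theorem isAxis_of_isAcyclic (hΓ : Γ.IsAcyclic)
    (hsm : ∀ (h : G) {u v : V}, Γ.Adj u v → Γ.Adj (h • u) (h • v)) {g : G} {γ : ℤ → V}
    (hadj : ∀ n, Γ.Adj (γ n) (γ (n + 1))) (hg : ∀ n, g • γ n = γ (n + 2))
    (htwo : ∀ x : V, 2 ≤ Γ.edist x (g • x)) : IsAxis Γ g γ := by
  have hne : ∀ n, γ n ≠ γ (n + 2) := by
    intro n h
    have := htwo (γ n)
    rw [hg, ← h, SimpleGraph.edist_self] at this
    simp at this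
  have hgeo := hΓ.dist_bi_infinite hadj hne
  have hed : ∀ m n : ℤ, Γ.edist (γ m) (γ n) = ((m - n).natAbs : ℕ∞) := fun m n => by
    rw [← (hgeo m n).1.coe_dist_eq_edist, (hgeo m n).2]
  have hγ2 : ∀ n, Γ.edist (γ n) (g • γ n) = 2 := fun n => by
    rw [hg, hed, show (n - (n + 2)).natAbs = 2 by lia]
    rfl
  have htl : translationLength Γ g = (2 : ℕ) :=
    le_antisymm ((iInf_le _ (γ 0)).trans (hγ2 0).le) (le_iInf htwo)
  refine ⟨hed, ⟨2, two_pos, htl, hg⟩, fun x hx => ⟨fun h => ?_, ?_⟩⟩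
  swap
  · rintro ⟨n, rfl⟩
    rw [hγ2, htl]
    rfl
  rw [htl] at h
  have hr : ∀ n, Γ.Reachable x (γ n) := fun n => hx.symm.trans (hgeo 0 n).1
  -- `γ n` is a vertex of `γ` closest to `x`
  obtain ⟨n, hn⟩ : ∃ n, ∀ m, Γ.dist x (γ n) ≤ Γ.dist x (γ m) :=
    ⟨_, fun m => Function.argmin_le (fun n => Γ.dist x (γ n)) m⟩
  obtain ⟨p, hp⟩ := (hr n).symm.exists_walk_length_eq_dist
  set d := Γ.dist x (γ n) with hd
  rw [SimpleGraph.dist_comm, ← hd] at hp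
  rcases Nat.eq_zero_or_pos d with h0 | hpos
  · exact ⟨n, ((hr n).dist_eq_zero_iff.mp h0).symm⟩
  exfalso
  obtain ⟨hplus, hminus⟩ : Γ.dist x (γ (n + 1)) = d + 1 ∧ Γ.dist x (γ (n - 1)) = d + 1 := by
    have h1 := hΓ.dist_eq_dist_add_one_of_adj_of_reachable x (hadj n) (hr n)
    have h2 := hΓ.dist_eq_dist_add_one_of_adj_of_reachable x
      (by simpa using (hadj (n - 1)).symm : Γ.Adj (γ n) (γ (n - 1))) (hr n)
    have h3 := hn (n + 1)
    have h4 := hn (n - 1)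
    lia
  have hplus2 : Γ.dist x (γ (n + 2)) = d + 1 + 1 := by
    rw [← hplus, show n + 2 = n + 1 + 1 by ring]
    exact hΓ.dist_eq_dist_add_one_of_ne (hr n) (hadj n) (hadj (n + 1))
      (by simpa [add_assoc] using hne n) hplus
  -- the vertices `γ (n + 1), γ (n + 2) = g • γ n, …, g • x`
  let q : ℕ → V := fun i => match i with
    | 0 => γ (n + 1)
    | i + 1 => g • p.getVert i
  have hq1 : q 1 = γ (n + 2) := by simp [q, hg]
  have hppath : p.IsPath := p.isPath_of_length_eq_dist (by rw [hp, SimpleGraph.dist_comm])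
  have := hΓ.dist_seq (x := x) (q := q) (N := d + 1) (n := d + 1)
    (by
      rintro (_ | i) hi
      · rw [hq1]
        simpa [q, add_assoc] using hadj (n + 1)
      · exact hsm g (p.adj_getVert_succ (by lia)))
    (by
      rintro (_ | i) hi heq
      · have h2 : g • γ (n - 1) = g • p.getVert 1 := by
          rw [hg, show n - 1 + 2 = n + 1 by ring]
          exact heq
        have h3 : Γ.dist x (p.getVert 1) ≤ d - 1 := by
          rw [SimpleGraph.dist_comm]
          refine (SimpleGraph.dist_le (p.drop 1)).trans ?_
          rw [SimpleGraph.Walk.drop_length, hp]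
        rw [← smul_left_cancel g h2, hminus] at h3
        lia
      · have := hppath.getVert_injOn (by simp; lia) (by simp; lia) (smul_left_cancel g heq)
        lia)
    (hr _) (by rw [hq1, hplus2, ← hplus]) le_rfl
  have hq : q (d + 1) = g • x := by
    simp [q, ← hp]
  have hreach : Γ.Reachable x (g • x) := SimpleGraph.reachable_of_edist_ne_top (by rw [h]; simp)
  rw [hq] at this
  rw [← hreach.coe_dist_eq_edist, this, Nat.cast_inj] at h
  simp only [q] at h
  lia

/-- If `h` moves two vertices of `γ` by at most `ε`, then it maps a vertex between them that is
farther than `ε` from both to a vertex of `γ` between them. -/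
theorem exists_smul_eq_of_mem_coarseFix (hΓ : Γ.IsAcyclic)
    (hsm : ∀ (h : G) {u v : V}, Γ.Adj u v → Γ.Adj (h • u) (h • v)) {γ : ℤ → V}
    (hadj : ∀ n, Γ.Adj (γ n) (γ (n + 1)))
    (hgeo : ∀ m n : ℤ, Γ.edist (γ m) (γ n) = ((m - n).natAbs : ℕ∞)) {ε L : ℕ} {h : G}
    (hh : h ∈ coarseFix Γ G ε (γ 0) (γ L)) {i : ℤ} (h1 : ε < i) (h2 : i < L - ε) :
    ∃ j, 0 ≤ j ∧ j ≤ (L : ℤ) ∧ h • γ i = γ j := by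
  classical
  have hr : ∀ m n, Γ.Reachable (γ m) (γ n) := fun m n =>
    SimpleGraph.reachable_of_edist_ne_top (by rw [hgeo]; simp)
  have hd : ∀ m n, Γ.dist (h • γ m) (h • γ n) = (m - n).natAbs := fun m n => by
    rw [dist_smul_smul hsm h (hr m n), ← ENat.natCast_inj, (hr m n).coe_dist_eq_edist, hgeo]
  obtain ⟨W, hW⟩ := SimpleGraph.exists_walk_of_adj_seq hadj 0 L
  obtain ⟨p, hp⟩ := SimpleGraph.exists_walk_of_edist_ne_top (G := Γ) (u := γ 0) (v := h • γ 0)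
    (ne_top_of_le_ne_top (by simp) hh.1)
  obtain ⟨q, hq⟩ := SimpleGraph.exists_walk_of_edist_ne_top (G := Γ) (u := γ L) (v := h • γ L)
    (ne_top_of_le_ne_top (by simp) hh.2)
  have hp' : p.length ≤ ε := by exact_mod_cast hp.le.trans hh.1
  have hq' : q.length ≤ ε := by exact_mod_cast hq.le.trans hh.2
  have hlt : ∀ {u v w : V} (r : Γ.Walk u v), w ∈ r.support → Γ.dist v w ≤ r.length := by
    intro u v w r hw
    rw [SimpleGraph.dist_comm]
    exact (SimpleGraph.dist_le _).trans (r.length_dropUntil_le_length hw)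
  have hmem := hΓ.mem_support_of_dist_add_dist (a := h • γ 0) (v := h • γ i) (b := h • γ L)
    (reachable_smul hsm h (hr _ _)) (reachable_smul hsm h (hr _ _)) (by simp only [hd]; lia)
    (p.reverse.append ((W.copy rfl (by rw [zero_add])).append q))
  rw [SimpleGraph.Walk.mem_support_append_iff, SimpleGraph.Walk.mem_support_append_iff,
    SimpleGraph.Walk.support_reverse, List.mem_reverse, SimpleGraph.Walk.support_copy] at hmem
  rcases hmem with hm | hm | hm
  · have := hlt p hm
    rw [hd] at this
    lia
  · obtain ⟨j, hj1, hj2, hj⟩ := hW _ hm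
    exact ⟨j, hj1, by lia, hj⟩
  · have := hlt q hm
    rw [hd] at this
    lia

/-- An element that translates the geodesic `γ` of a forest by `2` is WPD if the stabilizer of a
segment of `γ` is finite. -/
theorem isWPD_of_isAcyclic (hΓ : Γ.IsAcyclic)
    (hsm : ∀ (h : G) {u v : V}, Γ.Adj u v → Γ.Adj (h • u) (h • v)) {g : G} {γ : ℤ → V}
    (hadj : ∀ n, Γ.Adj (γ n) (γ (n + 1))) (hg : ∀ n, g • γ n = γ (n + 2))
    (hgeo : ∀ m n : ℤ, Γ.edist (γ m) (γ n) = ((m - n).natAbs : ℕ∞)) {r : ℕ}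
    (hfin : Finite (fixingSubgroup G (γ '' Set.Icc (-r) r))) : IsWPD Γ g := by
  have hpow : ∀ (N : ℕ) n, g ^ N • γ n = γ (n + 2 * N) := by
    intro N
    induction N with
    | zero => simp
    | succ N ih =>
      intro n
      rw [pow_succ, mul_smul, hg, ih]
      congr 1
      push_cast
      ring
  refine ⟨γ 0, fun ε => ⟨2 * (ε + r + 1), ?_⟩⟩
  set K := ε + r + 1 with hK
  rw [hpow, zero_add]
  -- an element of the coarse stabilizer is determined, up to a conjugate of the finite group, by
  -- its values on the segment of length `2 * r` with the middle `γ (2 * K)`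
  let I : Set ℤ := Set.Icc (-r) r
  let F : G → I → V := fun h i => h • γ (i + 2 * K)
  refine Set.Finite.of_finite_fibers F ?_ ?_
  · have hS : (γ '' Set.Icc 0 ((4 * K : ℕ) : ℤ)).Finite := (Set.finite_Icc _ _).image _
    refine (Set.Finite.pi' (fun _ : I => hS)).subset ?_
    rintro _ ⟨h, hh, rfl⟩ ⟨i, hi⟩
    obtain ⟨j, hj0, hj1, hj⟩ := exists_smul_eq_of_mem_coarseFix hΓ hsm hadj hgeo
      (L := 4 * K) (i := i + 2 * K)
      (by rwa [show ((4 * K : ℕ) : ℤ) = 2 * (2 * K : ℕ) by push_cast; ring])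
      (by have := hi.1; lia) (by have := hi.2; push_cast; lia)
    exact ⟨j, ⟨hj0, hj1⟩, hj.symm⟩
  · rintro _ ⟨h₀, -, rfl⟩
    have hf : {s : G | s ∈ fixingSubgroup G (γ '' I)}.Finite := hfin
    refine (hf.image fun s => h₀ * (g ^ K * s * (g ^ K)⁻¹)).subset ?_
    rintro h ⟨-, hh⟩
    refine ⟨(g ^ K)⁻¹ * (h₀⁻¹ * h) * g ^ K, ?_, by group⟩
    rw [Set.mem_ofPred_eq, mem_fixingSubgroup_iff]
    rintro _ ⟨i, hi, rfl⟩
    rw [mul_smul, hpow, mul_smul, mul_smul, show h • γ (i + 2 * K) = h₀ • γ (i + 2 * K) from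
      congrFun hh ⟨i, hi⟩, inv_smul_smul, ← hpow, inv_smul_smul]

end Forest

/-! ### Degrees of polynomial maps -/

namespace PolyMap

variable {k : Type*} [Field k]

open MvPolynomial

/-- The degree of a polynomial map: the larger of the total degrees of its components. -/
noncomputable def degree (w : PolyMap k) : ℕ := max w.fst.totalDegree w.snd.totalDegree

theorem totalDegree_aeval_le (w : PolyMap k) (p : MvPolynomial (Fin 2) k) :
    (aeval ![w.fst, w.snd] p).totalDegree ≤ p.totalDegree * w.degree := by
  rw [aeval_def, eval₂_eq']
  refine totalDegree_finsetSum_le fun m hm => ?_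
  rw [algebraMap_eq, Fin.prod_univ_two]
  have h0 : (w.fst ^ m 0).totalDegree ≤ m 0 * w.degree :=
    (totalDegree_pow _ _).trans (Nat.mul_le_mul_left _ (le_max_left _ _))
  have h1 : (w.snd ^ m 1).totalDegree ≤ m 1 * w.degree :=
    (totalDegree_pow _ _).trans (Nat.mul_le_mul_left _ (le_max_right _ _))
  have h2 : m 0 + m 1 ≤ p.totalDegree := by
    simpa [Finsupp.sum_fintype, Fin.sum_univ_two] using le_totalDegree hm
  calc _ ≤ (C (coeff m p)).totalDegree + ((w.fst ^ m 0).totalDegree + (w.snd ^ m 1).totalDegree) :=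
        (totalDegree_mul _ _).trans (Nat.add_le_add_left (totalDegree_mul _ _) _)
    _ ≤ 0 + (m 0 * w.degree + m 1 * w.degree) := by
        rw [totalDegree_C]; exact Nat.add_le_add_left (Nat.add_le_add h0 h1) _
    _ ≤ p.totalDegree * w.degree := by
        rw [zero_add, ← add_mul]; exact Nat.mul_le_mul_right _ h2

theorem degree_mul_le (f g : PolyMap k) : (f * g).degree ≤ f.degree * g.degree :=
  max_le ((totalDegree_aeval_le g _).trans (Nat.mul_le_mul_right _ (le_max_left _ _)))
    ((totalDegree_aeval_le g _).trans (Nat.mul_le_mul_right _ (le_max_right _ _)))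

theorem degree_affine_le (a b c d e f : k) : (affine a b c d e f).degree ≤ 1 := by
  have h : ∀ a b c : k, (C a * X 0 + C b * X 1 + C c : MvPolynomial (Fin 2) k).totalDegree ≤ 1 := by
    intro a b c
    have hX : ∀ (a : k) (i : Fin 2), (C a * X i : MvPolynomial (Fin 2) k).totalDegree ≤ 1 :=
      fun a i => (totalDegree_mul _ _).trans (by simp)
    exact (totalDegree_add _ _).trans (max_le ((totalDegree_add _ _).trans
      (max_le (hX _ _) (hX _ _))) (by simp))
  exact max_le (h _ _ _) (h _ _ _)

theorem totalDegree_polynomial_aeval_le (q : MvPolynomial (Fin 2) k) (P : Polynomial k) :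
    (Polynomial.aeval q P).totalDegree ≤ P.natDegree * q.totalDegree := by
  rw [Polynomial.aeval_eq_sum_range]
  refine totalDegree_finsetSum_le fun i hi => (totalDegree_smul_le _ _).trans
    ((totalDegree_pow _ _).trans (Nat.mul_le_mul_right _ ?_))
  exact Nat.lt_succ_iff.mp (Finset.mem_range.mp hi)

theorem totalDegree_pow_eq {q : MvPolynomial (Fin 2) k} (hq : q ≠ 0) (n : ℕ) :
    (q ^ n).totalDegree = n * q.totalDegree := by
  induction n with
  | zero => simp
  | succ n ih =>
    rw [pow_succ, totalDegree_mul_of_isDomain (pow_ne_zero _ hq) hq, ih, add_mul, one_mul]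

theorem totalDegree_polynomial_aeval {q : MvPolynomial (Fin 2) k} (hq : q.totalDegree ≠ 0)
    (P : Polynomial k) :
    (Polynomial.aeval q P).totalDegree = P.natDegree * q.totalDegree := by
  rcases Nat.eq_zero_or_pos P.natDegree with h0 | hpos
  · exact le_antisymm (totalDegree_polynomial_aeval_le q P) (by simp [h0])
  have hP : P ≠ 0 := by rintro rfl; simp at hpos
  have hq0 : q ≠ 0 := by rintro rfl; simp at hq
  have hlead : (Polynomial.aeval q (Polynomial.C P.leadingCoeff *
      Polynomial.X ^ P.natDegree)).totalDegree = P.natDegree * q.totalDegree := by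
    rw [map_mul, Polynomial.aeval_C, algebraMap_eq, map_pow, Polynomial.aeval_X,
      totalDegree_mul_of_isDomain (by simpa using hP) (pow_ne_zero _ hq0), totalDegree_C, zero_add]
    exact totalDegree_pow_eq hq0 _
  have hlt : (Polynomial.aeval q P.eraseLead).totalDegree < P.natDegree * q.totalDegree := by
    refine (totalDegree_polynomial_aeval_le q _).trans_lt
      (Nat.mul_lt_mul_of_pos_right ?_ (Nat.pos_of_ne_zero hq))
    exact P.eraseLead_natDegree_le.trans_lt (by lia)
  conv_lhs => rw [← P.eraseLead_add_C_mul_X_pow, map_add]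
  rw [totalDegree_add_eq_right_of_totalDegree_lt (by rwa [hlead]), hlead]

end PolyMap

namespace PlaneAut

variable {k : Type*} [Field k]

open MvPolynomial PolyMap

theorem degree_pos (w : PlaneAut k) : 0 < (w : PolyMap k).degree := by
  rcases Nat.eq_zero_or_pos (w : PolyMap k).degree with h | h
  · have := degree_mul_le ((w⁻¹ : PlaneAut k) : PolyMap k) w
    rw [h, Units.inv_mul] at this
    simp [degree] at this
  · exact h

theorem degree_le_one_of_mem_affineSubgroup {a : PlaneAut k} (ha : a ∈ affineSubgroup k) :
    (a : PolyMap k).degree ≤ 1 := by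
  obtain ⟨_, _, _, _, _, _, -, h⟩ := ha
  rw [h]
  exact degree_affine_le _ _ _ _ _ _

theorem degree_affine_mul {a : PlaneAut k} (ha : a ∈ affineSubgroup k) (w : PlaneAut k) :
    ((a * w : PlaneAut k) : PolyMap k).degree = (w : PolyMap k).degree := by
  have key : ∀ {a : PlaneAut k}, a ∈ affineSubgroup k → ∀ w : PlaneAut k,
      ((a * w : PlaneAut k) : PolyMap k).degree ≤ (w : PolyMap k).degree := by
    intro a ha w
    rw [Units.val_mul]
    refine (degree_mul_le _ _).trans ?_
    simpa using Nat.mul_le_mul_right (w : PolyMap k).degree (degree_le_one_of_mem_affineSubgroup ha)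
  refine le_antisymm (key ha w) ?_
  simpa using key (inv_mem ha) (a * w)

/-- If neither the second component of `w` nor that of `a w`, for an affine `a`, has the full degree
of `w`, then `a` is elementary. -/
theorem mem_elementarySubgroup_of_totalDegree_lt {a w : PlaneAut k} (ha : a ∈ affineSubgroup k)
    (h1 : (w : PolyMap k).snd.totalDegree < (w : PolyMap k).degree)
    (h2 : ((a * w : PlaneAut k) : PolyMap k).snd.totalDegree < (w : PolyMap k).degree) :
    a ∈ elementarySubgroup k := by
  obtain ⟨α, β, c, d, e, f, hD, hval⟩ := ha
  have hfst : (w : PolyMap k).fst.totalDegree = (w : PolyMap k).degree := by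
    rw [degree] at h1 ⊢
    lia
  have hc : c = 0 := by
    by_contra hc
    have hsnd : (C d * (w : PolyMap k).snd + C f).totalDegree < (w : PolyMap k).degree :=
      (totalDegree_add _ _).trans_lt (max_lt ((totalDegree_mul _ _).trans_lt (by simpa using h1))
        (by simpa using degree_pos w))
    have hcw : (C c * (w : PolyMap k).fst).totalDegree = (w : PolyMap k).degree := by
      rw [totalDegree_mul_of_isDomain (by simpa using hc), totalDegree_C, zero_add, hfst]
      intro h0
      rw [h0, totalDegree_zero] at hfst
      exact (degree_pos w).ne hfst
    have : ((a * w : PlaneAut k) : PolyMap k).snd =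
        C c * (w : PolyMap k).fst + (C d * (w : PolyMap k).snd + C f) := by
      simp [hval, affine, add_assoc]
    rw [this, totalDegree_add_eq_left_of_totalDegree_lt (by rwa [hcw]), hcw] at h2
    exact h2.false
  subst hc
  refine ⟨α, d, f, Polynomial.C β * Polynomial.X + Polynomial.C e, by simpa using hD, ?_⟩
  rw [hval]
  ext1 <;> simp [affine, elementary, add_assoc]

/-- If the second component of `w` has the full degree of `w`, then every elementary automorphism
that is not affine increases the degree of `w`. -/
theorem degree_lt_degree_elementary_mul {b w : PlaneAut k} (hb : b ∈ elementarySubgroup k)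
    (hbA : b ∉ affineSubgroup k)
    (h : (w : PolyMap k).snd.totalDegree = (w : PolyMap k).degree) :
    (w : PolyMap k).degree < ((b * w : PlaneAut k) : PolyMap k).degree := by
  obtain ⟨α, β, c, P, hD, hval⟩ := hb
  have hpos := degree_pos w
  have hP : 2 ≤ P.natDegree := by
    by_contra hP
    refine hbA ⟨α, P.coeff 1, 0, β, P.coeff 0, c, by simpa using hD, ?_⟩
    rw [hval, elementary, P.eq_X_add_C_of_natDegree_le_one (by lia)]
    ext1 <;> simp [affine, add_assoc]
  have hPw := totalDegree_polynomial_aeval (q := (w : PolyMap k).snd) (by lia) P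
  have hlt : (w : PolyMap k).degree < (Polynomial.aeval (w : PolyMap k).snd P).totalDegree := by
    rw [hPw, h]
    nlinarith
  have hfst : ((b * w : PlaneAut k) : PolyMap k).fst =
      C α * (w : PolyMap k).fst + Polynomial.aeval (w : PolyMap k).snd P := by
    simp [hval, elementary, ← Polynomial.aeval_algHom_apply]
  refine lt_of_lt_of_le ?_ (le_max_left _ _)
  rw [hfst, totalDegree_add_eq_right_of_totalDegree_lt]
  · exact hlt
  · refine ((totalDegree_mul _ _).trans ?_).trans_lt hlt
    rw [totalDegree_C, zero_add]
    exact le_max_left _ _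

/-- The height of a vertex `f A` is the degree of `f⁻¹`; the vertices `f B` have height `0`. -/
noncomputable def height :
    (PlaneAut k ⧸ affineSubgroup k) ⊕ (PlaneAut k ⧸ elementarySubgroup k) → ℕ :=
  Sum.elim (fun q => ((q.out⁻¹ : PlaneAut k) : PolyMap k).degree) fun _ => 0

theorem height_inl (f : PlaneAut k) : height (Sum.inl (f : PlaneAut k ⧸ affineSubgroup k)) =
    ((f⁻¹ : PlaneAut k) : PolyMap k).degree := by
  obtain ⟨a, ha⟩ := QuotientGroup.mk_out_eq_mul (affineSubgroup k) f
  rw [height, Sum.elim_inl, ha, mul_inv_rev, degree_affine_mul (inv_mem a.2)]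

/-- The Bass–Serre graph is a forest. In terms of the inverses `w = (w₁, w₂)` of the automorphisms
`f`, the neighbours `f B` of `f A` correspond to the linear combinations of `w₁` and `w₂`, up to
scalars, and at most one of these combinations has a degree below that of `w`. -/
theorem isAcyclic_tree : (tree k).IsAcyclic := by
  -- beyond a neighbour `f B` for which `w₂` has full degree, the height is larger
  have up : ∀ f : PlaneAut k, ((f⁻¹ : PlaneAut k) : PolyMap k).snd.totalDegree =
      ((f⁻¹ : PlaneAut k) : PolyMap k).degree → ∀ u,
      (tree k).Adj (Sum.inr (f : PlaneAut k ⧸ elementarySubgroup k)) u →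
      u ≠ Sum.inl (f : PlaneAut k ⧸ affineSubgroup k) →
      ((f⁻¹ : PlaneAut k) : PolyMap k).degree < height u := by
    rintro f hf u ⟨f', ⟨h, -⟩ | ⟨h, rfl⟩⟩ hne
    · cases h
    have hb : f⁻¹ * f' ∈ elementarySubgroup k := QuotientGroup.eq.mp (Sum.inr_injective h)
    have hb' : f'⁻¹ * f ∈ elementarySubgroup k := by simpa using inv_mem hb
    rw [height_inl, show f'⁻¹ = f'⁻¹ * f * f⁻¹ by group]
    exact degree_lt_degree_elementary_mul hb'
      (fun hA => hne (congrArg Sum.inl (QuotientGroup.eq.mpr hA))) hf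
  refine SimpleGraph.isAcyclic_of_height height ?_
  rintro v _ _ ⟨f, ⟨rfl, rfl⟩ | ⟨rfl, rfl⟩⟩ ⟨f', ⟨h, rfl⟩ | ⟨h, rfl⟩⟩ hne
  · refine Or.inr ?_
    have ha : f⁻¹ * f' ∈ affineSubgroup k := QuotientGroup.eq.mp (Sum.inl_injective h)
    have ha' : f'⁻¹ * f ∈ affineSubgroup k := by simpa using inv_mem ha
    have hmul : f'⁻¹ = f'⁻¹ * f * f⁻¹ := by group
    have hdeg : ((f'⁻¹ : PlaneAut k) : PolyMap k).degree =
        ((f⁻¹ : PlaneAut k) : PolyMap k).degree := by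
      rw [hmul, degree_affine_mul ha']
    by_cases h1 : ((f⁻¹ : PlaneAut k) : PolyMap k).snd.totalDegree =
      ((f⁻¹ : PlaneAut k) : PolyMap k).degree
    · exact Or.inl (by rw [height_inl]; exact up f h1)
    by_cases h2 : ((f'⁻¹ : PlaneAut k) : PolyMap k).snd.totalDegree =
      ((f'⁻¹ : PlaneAut k) : PolyMap k).degree
    · exact Or.inr (by rw [height_inl, ← hdeg, h]; exact up f' h2)
    exfalso
    refine hne (congrArg Sum.inr (QuotientGroup.eq.mpr ?_)).symm
    refine mem_elementarySubgroup_of_totalDegree_lt ha' (lt_of_le_of_ne (le_max_right _ _) h1) ?_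
    rw [← hmul, ← hdeg]
    exact lt_of_le_of_ne (le_max_right _ _) h2
  · cases h
  · cases h
  · refine Or.inl ?_
    rw [height_inl]
    exact degree_pos _

end PlaneAut

/-! ### Dynamics of `bt` -/

namespace PlaneAut

variable {k : Type*} [Field k]

open MvPolynomial PolyMap

theorem coe_b_mul_t : ((b k * t k : PlaneAut k) : PolyMap k) = ⟨X 0 ^ 2 - X 1, X 0⟩ := by
  ext1 <;> simp [b, t]
  ring

theorem inv_b : (b k)⁻¹ = b k := rfl

theorem inv_t : (t k)⁻¹ = t k := rfl

theorem b_mem : b k ∈ elementarySubgroup k :=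
  ⟨-1, 1, 0, Polynomial.X ^ 2, by simp, by ext1 <;> simp [b, elementary]⟩

theorem t_mem : t k ∈ affineSubgroup k :=
  ⟨0, 1, 1, 0, 0, 0, by simp, by ext1 <;> simp [t, affine]⟩

theorem totalDegree_b_mul_t_pow (n : ℕ) :
    (((b k * t k) ^ n : PlaneAut k) : PolyMap k).fst.totalDegree = 2 ^ n ∧
      (((b k * t k) ^ n : PlaneAut k) : PolyMap k).snd.totalDegree ≤ 2 ^ n := by
  induction n with
  | zero => simp
  | succ n ih =>
    obtain ⟨h1, h2⟩ := ih
    rw [pow_succ', Units.val_mul, coe_b_mul_t]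
    generalize (((b k * t k) ^ n : PlaneAut k) : PolyMap k) = w at h1 h2
    have hw : w.fst ≠ 0 := by
      rintro h
      rw [h, totalDegree_zero] at h1
      exact (pow_ne_zero n two_ne_zero) h1.symm
    have hsq : (w.fst ^ 2).totalDegree = 2 ^ (n + 1) := by
      rw [totalDegree_pow_eq hw, h1, pow_succ']
    have hlt : 2 ^ n < 2 ^ (n + 1) := Nat.pow_lt_pow_right one_lt_two n.lt_succ_self
    refine ⟨?_, by simpa [h1] using hlt.le⟩
    have : (⟨X 0 ^ 2 - X 1, X 0⟩ * w : PolyMap k).fst = w.fst ^ 2 + -w.snd := by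
      simp [sub_eq_add_neg]
    rw [this, totalDegree_add_eq_left_of_totalDegree_lt, hsq]
    rw [totalDegree_neg, hsq]
    exact h2.trans_lt hlt

/-- The degrees of the iterates of an elementary automorphism are bounded. -/
theorem exists_degree_pow_le_of_mem_elementarySubgroup {h : PlaneAut k}
    (hh : h ∈ elementarySubgroup k) :
    ∃ D, ∀ n : ℕ, ((h ^ n : PlaneAut k) : PolyMap k).degree ≤ D := by
  obtain ⟨α, β, c, P, hD, hval⟩ := hh
  have key : ∀ n : ℕ, ∃ α' β' c' P', Polynomial.natDegree P' ≤ P.natDegree ∧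
      ((h ^ n : PlaneAut k) : PolyMap k) = elementary α' β' c' P' := by
    intro n
    induction n with
    | zero => exact ⟨1, 1, 0, 0, by simp, by rw [elementary_one, pow_zero, Units.val_one]⟩
    | succ n ih =>
      obtain ⟨α', β', c', P', hP', hn⟩ := ih
      refine ⟨_, _, _, _, ?_, by rw [pow_succ', Units.val_mul, hn, hval, elementary_mul]⟩
      refine (Polynomial.natDegree_add_le _ _).trans (max_le ?_ ?_)
      · exact (Polynomial.natDegree_C_mul_le _ _).trans hP'
      · rw [Polynomial.natDegree_comp]
        exact (Nat.mul_le_mul_left _ Polynomial.natDegree_linear_le).trans (by simp)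
  refine ⟨P.natDegree + 1, fun n => ?_⟩
  obtain ⟨α', β', c', P', hP', hn⟩ := key n
  have hX : ∀ (a : k) (i : Fin 2), (C a * X i : MvPolynomial (Fin 2) k).totalDegree ≤ 1 :=
    fun a i => (totalDegree_mul _ _).trans (by simp)
  rw [hn]
  refine max_le ((totalDegree_add _ _).trans (max_le ((hX _ _).trans (by lia)) ?_))
    ((totalDegree_add _ _).trans (max_le ((hX _ _).trans (by lia)) (by simp)))
  refine (totalDegree_polynomial_aeval_le _ _).trans ?_
  rw [totalDegree_X]
  lia

/-- The degrees of the iterates of `bt` are unbounded, even after conjugation. -/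
theorem not_degree_conj_pow_le (f : PlaneAut k) (D : ℕ) :
    ¬ ∀ n : ℕ, (((f⁻¹ * (b k * t k) * f) ^ n : PlaneAut k) : PolyMap k).degree ≤ D := by
  intro h
  set F := (f : PolyMap k).degree
  set F' := ((f⁻¹ : PlaneAut k) : PolyMap k).degree
  have key : ∀ n : ℕ, 2 ^ n ≤ F * D * F' := by
    intro n
    have h1 : (b k * t k) ^ n = f * (f⁻¹ * (b k * t k) * f) ^ n * f⁻¹ := by
      have h2 := conj_pow (i := n) (a := f) (b := f⁻¹ * (b k * t k) * f)
      rw [← h2]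
      group
    rw [← (totalDegree_b_mul_t_pow (k := k) n).1]
    refine (le_max_left _ (((b k * t k) ^ n : PlaneAut k) : PolyMap k).snd.totalDegree).trans ?_
    change PolyMap.degree _ ≤ _
    rw [h1, Units.val_mul, Units.val_mul]
    exact (degree_mul_le _ _).trans (Nat.mul_le_mul_right _
      ((degree_mul_le _ _).trans (Nat.mul_le_mul_left _ (h n))))
  exact absurd (key (F * D * F')) (not_le.mpr Nat.lt_two_pow_self)

theorem b_mul_t_smul_ne
    (x : (PlaneAut k ⧸ affineSubgroup k) ⊕ (PlaneAut k ⧸ elementarySubgroup k)) :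
    x ≠ (b k * t k) • x := by
  rcases x with q | q <;> obtain ⟨f, rfl⟩ := QuotientGroup.mk_surjective q <;> intro h
  · have hA : f⁻¹ * (b k * t k * f) ∈ affineSubgroup k := QuotientGroup.eq.mp (Sum.inl_injective h)
    rw [← mul_assoc] at hA
    exact not_degree_conj_pow_le f 1 fun n =>
      degree_le_one_of_mem_affineSubgroup (Subgroup.pow_mem _ hA n)
  · have hB : f⁻¹ * (b k * t k * f) ∈ elementarySubgroup k :=
      QuotientGroup.eq.mp (Sum.inr_injective h)
    rw [← mul_assoc] at hB
    obtain ⟨D, hD⟩ := exists_degree_pow_le_of_mem_elementarySubgroup hB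
    exact not_degree_conj_pow_le f D hD

/-- No vertex is moved to an adjacent one, because the action preserves the two kinds of vertices,
and none is fixed. -/
theorem two_le_edist_b_mul_t_smul
    (x : (PlaneAut k ⧸ affineSubgroup k) ⊕ (PlaneAut k ⧸ elementarySubgroup k)) :
    2 ≤ (tree k).edist x ((b k * t k) • x) := by
  by_contra hlt
  have hle : (tree k).edist x ((b k * t k) • x) ≤ 1 := by
    rw [not_le] at hlt
    exact Order.le_of_lt_add_one (by rwa [one_add_one_eq_two])
  rcases SimpleGraph.edist_le_one_iff_adj_or_eq.mp hle with h | h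
  · obtain ⟨f, ⟨h1, h2⟩ | ⟨h1, h2⟩⟩ := h <;> rw [h1] at h2 <;> cases h2
  · exact b_mul_t_smul_ne x h

/-- The axis of `bt`, with the vertices `(bt)^m A` in the places `2 m` and `(bt)^m B` in the places
`2 m + 1`. -/
noncomputable def axis (k : Type*) [Field k] (n : ℤ) :
    (PlaneAut k ⧸ affineSubgroup k) ⊕ (PlaneAut k ⧸ elementarySubgroup k) :=
  if Even n then vertexA ((b k * t k) ^ (n / 2)) else vertexB ((b k * t k) ^ (n / 2))

theorem axis_even (m : ℤ) : axis k (2 * m) = vertexA ((b k * t k) ^ m) := by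
  simp [axis]

theorem axis_odd (m : ℤ) : axis k (2 * m + 1) = vertexB ((b k * t k) ^ m) := by
  have h : (2 * m + 1) / 2 = m := by lia
  simp [axis, h]

theorem smul_axis (n : ℤ) : (b k * t k) • axis k n = axis k (n + 2) := by
  rcases Int.even_or_odd' n with ⟨m, rfl | rfl⟩
  · rw [show 2 * m + 2 = 2 * (1 + m) by ring, axis_even, axis_even, zpow_one_add]
    rfl
  · rw [show 2 * m + 1 + 2 = 2 * (1 + m) + 1 by ring, axis_odd, axis_odd, zpow_one_add]
    rfl

theorem vertexA_mul_of_mem {f a : PlaneAut k} (ha : a ∈ affineSubgroup k) :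
    vertexA (f * a) = vertexA f :=
  congrArg Sum.inl (QuotientGroup.mk_mul_of_mem f ha)

theorem vertexB_mul_of_mem {f a : PlaneAut k} (ha : a ∈ elementarySubgroup k) :
    vertexB (f * a) = vertexB f :=
  congrArg Sum.inr (QuotientGroup.mk_mul_of_mem f ha)

theorem adj_axis (n : ℤ) : (tree k).Adj (axis k n) (axis k (n + 1)) := by
  rcases Int.even_or_odd' n with ⟨m, rfl | rfl⟩
  · rw [axis_even, axis_odd]
    exact ⟨_, Or.inl ⟨rfl, rfl⟩⟩
  · rw [show 2 * m + 1 + 1 = 2 * (m + 1) by ring, axis_even, axis_odd, zpow_add_one, ← mul_assoc,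
      vertexA_mul_of_mem t_mem, ← vertexB_mul_of_mem b_mem]
    exact ⟨_, Or.inr ⟨rfl, rfl⟩⟩

theorem tree_adj_smul (h : PlaneAut k)
    {u v : (PlaneAut k ⧸ affineSubgroup k) ⊕ (PlaneAut k ⧸ elementarySubgroup k)}
    (huv : (tree k).Adj u v) : (tree k).Adj (h • u) (h • v) :=
  bassSerre_adj_smul _ _ h huv

theorem isAxis_axis : IsAxis (tree k) (b k * t k) (axis k) :=
  isAxis_of_isAcyclic isAcyclic_tree tree_adj_smul adj_axis smul_axis
    two_le_edist_b_mul_t_smul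

theorem axis_neg_three : axis k (-3) = vertexB (t k * b k * t k) := by
  rw [show (-3 : ℤ) = 2 * (-2) + 1 by norm_num, axis_odd,
    ← vertexB_mul_of_mem (f := t k * b k * t k) b_mem, zpow_neg, zpow_two, mul_inv_rev, mul_inv_rev,
    inv_b, inv_t, mul_assoc (t k * b k)]

theorem axis_neg_two : axis k (-2) = vertexA (t k * b k) := by
  rw [show (-2 : ℤ) = 2 * (-1) by norm_num, axis_even, zpow_neg_one, mul_inv_rev, inv_b, inv_t]

theorem axis_neg_one : axis k (-1) = vertexB (t k) := by
  rw [show (-1 : ℤ) = 2 * (-1) + 1 by norm_num, axis_odd, zpow_neg_one, mul_inv_rev, inv_b, inv_t,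
    vertexB_mul_of_mem b_mem]

theorem axis_zero : axis k 0 = vertexA 1 := by
  simpa using axis_even (k := k) 0

theorem axis_one : axis k 1 = vertexB 1 := by
  simpa using axis_odd (k := k) 0

theorem axis_two : axis k 2 = vertexA (b k) := by
  rw [show (2 : ℤ) = 2 * 1 by norm_num, axis_even, zpow_one, vertexA_mul_of_mem t_mem]

theorem axis_three : axis k 3 = vertexB (b k * t k) := by
  rw [show (3 : ℤ) = 2 * 1 + 1 by norm_num, axis_odd, zpow_one]

/-! ### The stabilizer of a segment of the axis -/

theorem pderiv_zero_snd_of_mem_elementarySubgroup {h : PlaneAut k}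
    (hh : h ∈ elementarySubgroup k) : pderiv 0 (h : PolyMap k).snd = 0 := by
  obtain ⟨α, β, c, P, -, hval⟩ := hh
  simp [hval, elementary, pderiv_X]

theorem smul_vertexA_eq_iff {h f : PlaneAut k} :
    h • vertexA f = vertexA f ↔ f⁻¹ * h * f ∈ affineSubgroup k := by
  rw [eq_comm, mul_assoc]
  exact Sum.inl_injective.eq_iff.trans QuotientGroup.eq

theorem smul_vertexB_eq_iff {h f : PlaneAut k} :
    h • vertexB f = vertexB f ↔ f⁻¹ * h * f ∈ elementarySubgroup k := by
  rw [eq_comm, mul_assoc]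
  exact Sum.inr_injective.eq_iff.trans QuotientGroup.eq

/-- A diagonal affine automorphism `(a x + e, d y + f)` that fixes the vertex `btB` satisfies
`a = d²` and `f = 0`: its conjugate by `bt` has the second component
`a y + (d² - a) x² + 2 d f x + f² - e`, which may not involve `x`. -/
theorem eq_sq_and_eq_zero_of_conj_mem (h2 : (2 : k) ≠ 0) {h : PlaneAut k} {a d e f : k} (hd : d ≠ 0)
    (hval : (h : PolyMap k) = affine a 0 0 d e f)
    (hB : (b k * t k)⁻¹ * h * (b k * t k) ∈ elementarySubgroup k) : a = d ^ 2 ∧ f = 0 := by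
  have h0 := pderiv_zero_snd_of_mem_elementarySubgroup hB
  have hC2 : (C 2 : MvPolynomial (Fin 2) k) = 2 := map_ofNat C 2
  have hsnd : (((b k * t k)⁻¹ * h * (b k * t k) : PlaneAut k) : PolyMap k).snd =
      C a * X 1 + C (d ^ 2 - a) * X 0 ^ 2 + C (2 * d * f) * X 0 + C (f ^ 2 - e) := by
    rw [mul_inv_rev, inv_b, inv_t]
    simp only [Units.val_mul, hval]
    simp [b, t, affine, hC2]
    ring
  rw [hsnd] at h0
  have hpd : (C (2 * (d ^ 2 - a)) * X 0 + C (2 * d * f) : MvPolynomial (Fin 2) k) = 0 := by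
    rw [← h0]
    simp [pderiv_X, Derivation.leibniz_pow]
    rw [hC2]
    ring
  have hf := congrArg (eval 0) hpd
  have ha := congrArg (eval 1) hpd
  simp only [map_add, map_mul, eval_C, eval_X, map_zero, Pi.zero_apply, Pi.one_apply, mul_zero,
    zero_add, mul_one, mul_eq_zero, h2, hd, false_or] at hf ha
  subst hf
  simp only [mul_zero, add_zero, mul_eq_zero, h2, false_or, sub_eq_zero] at ha
  exact ⟨ha.symm, rfl⟩

/-- The elements that fix the segment of length `6` are the maps `(a x, a² y)` with `a³ = 1`. -/
theorem exists_eq_of_mem_fixingSubgroup (h2 : (2 : k) ≠ 0) {h : PlaneAut k}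
    (hh : h ∈ fixingSubgroup (PlaneAut k) (axis k '' Set.Icc (-3) 3)) :
    ∃ a : k, a ^ 3 = 1 ∧ (h : PolyMap k) = affine a 0 0 (a ^ 2) 0 0 := by
  have fix : ∀ n : ℤ, -3 ≤ n → n ≤ 3 → h • axis k n = axis k n := fun n h1 h3 =>
    (mem_fixingSubgroup_iff _).mp hh _ ⟨n, ⟨h1, h3⟩, rfl⟩
  have hA := fix 0 (by norm_num) (by norm_num)
  rw [axis_zero, smul_vertexA_eq_iff, inv_one, one_mul, mul_one] at hA
  have hB := fix 1 (by norm_num) (by norm_num)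
  rw [axis_one, smul_vertexB_eq_iff, inv_one, one_mul, mul_one] at hB
  have htB := fix (-1) (by norm_num) (by norm_num)
  rw [axis_neg_one, smul_vertexB_eq_iff, inv_t] at htB
  have hbtB := fix 3 (by norm_num) (by norm_num)
  rw [axis_three, smul_vertexB_eq_iff] at hbtB
  have htbtB := fix (-3) (by norm_num) (by norm_num)
  rw [axis_neg_three, smul_vertexB_eq_iff] at htbtB
  obtain ⟨a, β, c, d, e, f, hD, hval⟩ := hA
  -- fixing `B` and `tB` makes the linear part diagonal
  have hc : c = 0 := by
    have := pderiv_zero_snd_of_mem_elementarySubgroup hB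
    simpa [hval, affine, pderiv_X] using this
  have hβ : β = 0 := by
    have := pderiv_zero_snd_of_mem_elementarySubgroup htB
    simpa [hval, affine, pderiv_X, t] using this
  subst hc hβ
  obtain ⟨ha0, hd0⟩ : a ≠ 0 ∧ d ≠ 0 := by simpa using hD
  obtain ⟨had, rfl⟩ := eq_sq_and_eq_zero_of_conj_mem h2 hd0 hval hbtB
  have hval' : ((t k * h * t k : PlaneAut k) : PolyMap k) = affine d 0 0 a 0 e := by
    ext1 <;> simp [hval, affine, t]
  obtain ⟨hda, rfl⟩ := eq_sq_and_eq_zero_of_conj_mem h2 ha0 hval' (by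
    convert htbtB using 1
    simp only [mul_inv_rev, inv_t, mul_assoc])
  refine ⟨a, mul_left_cancel₀ ha0 ?_, by rw [hval, ← hda]⟩
  calc a * a ^ 3 = (a ^ 2) ^ 2 := by ring
    _ = a * 1 := by rw [← hda, ← had, mul_one]

theorem exists_injective_fixingSubgroup (h2 : (2 : k) ≠ 0) :
    ∃ F : fixingSubgroup (PlaneAut k) (axis k '' Set.Icc (-3) 3) → rootsOfUnity 3 k,
      Function.Injective F := by
  choose F hF hval using fun h : fixingSubgroup (PlaneAut k) (axis k '' Set.Icc (-3) 3) =>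
    exists_eq_of_mem_fixingSubgroup h2 h.2
  refine ⟨fun h => rootsOfUnity.mkOfPowEq (F h) (hF h), fun h h' heq => ?_⟩
  have hFF : F h = F h' := congrArg (fun z : rootsOfUnity 3 k => ((z : kˣ) : k)) heq
  exact Subtype.ext (Units.ext (by rw [hval, hval, hFF]))

theorem finite_fixingSubgroup (h2 : (2 : k) ≠ 0) :
    Finite (fixingSubgroup (PlaneAut k) (axis k '' Set.Icc (-3) 3)) :=
  let ⟨_, hF⟩ := exists_injective_fixingSubgroup h2
  Finite.of_injective _ hF

theorem card_fixingSubgroup_le (h2 : (2 : k) ≠ 0) :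
    Nat.card (fixingSubgroup (PlaneAut k) (axis k '' Set.Icc (-3) 3)) ≤ 3 := by
  obtain ⟨F, hF⟩ := exists_injective_fixingSubgroup h2
  exact (Nat.card_le_card_of_injective F hF).trans (card_rootsOfUnity k 3)

end PlaneAut

theorem mainTheorem3 {k : Type*} [Field k] (hk : ringChar k ≠ 2) :
    ((PlaneAut.b k * PlaneAut.t k : PlaneAut k) : PolyMap k) =
        ⟨MvPolynomial.X 0 ^ 2 - MvPolynomial.X 1, MvPolynomial.X 0⟩ ∧
      IsLoxodromic (PlaneAut.tree k) (PlaneAut.b k * PlaneAut.t k) ∧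
      IsWPD (PlaneAut.tree k) (PlaneAut.b k * PlaneAut.t k) ∧
      ∃ γ : ℤ → (PlaneAut k ⧸ PlaneAut.affineSubgroup k) ⊕
          (PlaneAut k ⧸ PlaneAut.elementarySubgroup k),
        IsAxis (PlaneAut.tree k) (PlaneAut.b k * PlaneAut.t k) γ ∧
        γ (-3) = PlaneAut.vertexB (PlaneAut.t k * PlaneAut.b k * PlaneAut.t k) ∧
        γ (-2) = PlaneAut.vertexA (PlaneAut.t k * PlaneAut.b k) ∧
        γ (-1) = PlaneAut.vertexB (PlaneAut.t k) ∧
        γ 0 = PlaneAut.vertexA 1 ∧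
        γ 1 = PlaneAut.vertexB 1 ∧
        γ 2 = PlaneAut.vertexA (PlaneAut.b k) ∧
        γ 3 = PlaneAut.vertexB (PlaneAut.b k * PlaneAut.t k) ∧
        Finite (fixingSubgroup (PlaneAut k) (γ '' Set.Icc (-3) 3)) ∧
        Nat.card (fixingSubgroup (PlaneAut k) (γ '' Set.Icc (-3) 3)) ≤ 3 := by
  have h2 : (2 : k) ≠ 0 := Ring.two_ne_zero hk
  open PlaneAut in
  exact ⟨coe_b_mul_t, ⟨axis k, isAxis_axis⟩,
    isWPD_of_isAcyclic isAcyclic_tree tree_adj_smul adj_axis smul_axis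
      isAxis_axis.1 (r := 3) (by simpa using finite_fixingSubgroup h2),
    axis k, isAxis_axis, axis_neg_three, axis_neg_two, axis_neg_one, axis_zero, axis_one, axis_two,
    axis_three, finite_fixingSubgroup h2, card_fixingSubgroup_le h2⟩
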